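/- Let $p$ be a prime. Identify $H^*(BU;\mathbb{Z}_p)$, in the usual way, with the ring of symmetric formal sums of bounded degree, with coefficients in $\mathbb{Z}_p$, in countably many variables $x_1,x_2,\dots$ of degree $2$, and, for $n\ge 0$, identify $H^*(BU(n);\mathbb{Z}_p)$ with the ring of symmetric polynomials in $x_1,\dots,x_n$, so that setting $x_{n+1}=x_{n+2}=\dots=0$ is the restriction map $H^*(BU;\mathbb{Z}_p)\to H^*(BU(n);\mathbb{Z}_p)$. Under this identification the mod $p$ Chern class $c_k$, of degree $2k$, is the $k$-th elementary symmetric function, and the Steenrod powers $P^j$, which raise degree by $2(p-1)j$ (and are $Sq^{2j}$ for $p=2$), are given by the Cartan formula and by $P^0(x_m)=x_m$, $P^1(x_m)=x_m^p$, $P^j(x_m)=0$ for $j\ge 2$. Let $k=\lambda p^i$ with integers $i\ge 0$, $\lambda>p$ and $p\nmid\lambda$. Below, "modulo products" means: modulo $\mathbb{Z}_p$-linear combinations of products $c_{j_1}\cdots c_{j_r}$ with $1\le j_s<k$ and $j_1+\dots+j_r=k$. (1) For every prime $p$ (odd or even), the class $c_k\in H^{2k}(BU;\mathbb{Z}_p)$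 is, modulo products, a nonzero multiple of $P^{p^i}(c_{(\lambda-p+1)p^i})$. For $p=2$ this is $P^{2^i}(c_{(\lambda-1)2^i})=Sq^{2^{i+1}}(c_{(\lambda-1)2^i})$; in particular it covers the case $\lambda\equiv 3 \pmod 4$. (2) If $p=2$ and $\lambda\equiv 1\pmod 4$, then $c_k$ is, modulo products, also a nonzero multiple of $P^{2^{i+1}}(c_{(\lambda-2)2^i})=Sq^{2^{i+2}}(c_{(\lambda-2)2^i})$. In both cases the same relation, with the same nonzero scalar, holds for the Chern classes in $H^*(BU(n);\mathbb{Z}_p)$ for every $n$, that is, for the universal complex vector bundle of rank $n$. -/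

import Mathlib

/-!
The mod `p` cohomology of `BU`, in the splitting-principle description used for symmetric
polynomial computations.

* `H^*(BT^n; Z_p)` (`T^n` the diagonal torus of `U(n)`) is `Z_p[x_1, ..., x_n]`, with `x_i` in
  cohomological degree `2`.
* `H^*(BU(n); Z_p)` is its subring of symmetric polynomials, and `c_k` is the `k`-th elementary
  symmetric polynomial.
* `H^*(BU; Z_p)` is the (graded) inverse limit of the rings `H^*(BU(n); Z_p)` along the restriction
  maps which set the last variable to zero; an element is a symmetric formal sum of bounded degree
  in countably many variables `x_1, x_2, ...`.
* The Steenrod powers `P^j` (`P^j = Sq^{2j}` if `p = 2`) are determined by the Cartan formula and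
  `P^0 x_i = x_i`, `P^1 x_i = x_i ^ p`, `P^j x_i = 0` for `j ≥ 2`.
-/

namespace CohomologyBU

open MvPolynomial

noncomputable section

/-- `Z_p[x_i : i ∈ σ]`; for `σ = Fin n` this is `H^*(BT^n; Z_p)`. -/
abbrev HBT (p : ℕ) (σ : Type) : Type := MvPolynomial σ (ZMod p)

/-- The total Steenrod power `f ↦ ∑_j P^j(f) t^j`: the ring homomorphism with
`x_i ↦ x_i + x_i ^ p t`. -/
def totalPower (p : ℕ) (σ : Type) : HBT p σ →ₐ[ZMod p] Polynomial (HBT p σ) :=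
  aeval fun i : σ => Polynomial.C (X i) + Polynomial.C (X i ^ p) * Polynomial.X

/-- The Steenrod power `P^j` on `Z_p[x_i : i ∈ σ]`. -/
def power (p : ℕ) (σ : Type) (j : ℕ) : HBT p σ →ₗ[ZMod p] HBT p σ :=
  ((Polynomial.lcoeff (HBT p σ) j).restrictScalars (ZMod p)) ∘ₗ (totalPower p σ).toLinearMap

theorem power_apply (p : ℕ) (σ : Type) (j : ℕ) (f : HBT p σ) :
    power p σ j f = (totalPower p σ f).coeff j := rfl

/-- The Cartan formula. -/
theorem power_mul (p : ℕ) (σ : Type) (j : ℕ) (f g : HBT p σ) :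
    power p σ j (f * g) =
      ∑ ab ∈ Finset.HasAntidiagonal.antidiagonal j, power p σ ab.1 f * power p σ ab.2 g := by
  simp only [power_apply, map_mul, Polynomial.coeff_mul]

theorem power_X (p : ℕ) (σ : Type) (j : ℕ) (i : σ) :
    power p σ j (X i) = if j = 0 then X i else if j = 1 then X i ^ p else 0 := by
  rcases j with _ | _ | j <;> simp [power_apply, totalPower, Polynomial.coeff_X, Polynomial.coeff_C,
    -map_pow]

theorem power_C (p : ℕ) (σ : Type) (j : ℕ) (a : ZMod p) :
    power p σ j (C a) = if j = 0 then C a else 0 := by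
  have : totalPower p σ (C a) = Polynomial.C (C a) := by
    rw [← MvPolynomial.algebraMap_eq, AlgHom.commutes]; rfl
  rw [power_apply, this, Polynomial.coeff_C]

/-- Steenrod powers are natural for algebra homomorphisms that send each variable to a variable
or to zero. -/
theorem power_comm {p : ℕ} [Fact p.Prime] {σ τ : Type} (φ : HBT p σ →ₐ[ZMod p] HBT p τ)
    (hφ : ∀ i, φ (X i) = 0 ∨ ∃ l, φ (X i) = X l) (j : ℕ) (f : HBT p σ) :
    φ (power p σ j f) = power p τ j (φ f) := by
  have key : (Polynomial.mapAlgHom φ).comp (totalPower p σ) = (totalPower p τ).comp φ := by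
    apply MvPolynomial.algHom_ext
    intro i
    rcases hφ i with h | ⟨l, h⟩ <;>
      simp [totalPower, h, (Fact.out : p.Prime).ne_zero]
  have := congrArg (fun q => Polynomial.coeff q j) (DFunLike.congr_fun key f)
  simpa [power_apply] using this

theorem power_isSymmetric {p : ℕ} [Fact p.Prime] {σ : Type} (j : ℕ) {f : HBT p σ}
    (hf : f.IsSymmetric) : (power p σ j f).IsSymmetric := by
  intro e
  rw [power_comm (rename e) (fun i => Or.inr ⟨e i, rename_X e i⟩), hf e]

theorem totalDegree_power_monomial_le {p : ℕ} [Fact p.Prime] {σ : Type} (s : σ →₀ ℕ)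
    (a : ZMod p) (j : ℕ) : (power p σ j (monomial s a)).totalDegree ≤ p * s.degree := by
  classical
  have hp : 1 ≤ p := (Fact.out : p.Prime).one_le
  have : Nontrivial (ZMod p) := ZMod.nontrivial p
  induction s using Finsupp.induction_linear generalizing a j with
  | zero =>
    rw [show monomial (0 : σ →₀ ℕ) a = C a from rfl, power_C]
    split_ifs <;> simp
  | add s t hs ht =>
    rw [show monomial (s + t) a = monomial s a * monomial t (1 : ZMod p) by
      rw [monomial_mul, mul_one], power_mul]
    refine (totalDegree_finsetSum _ _).trans (Finset.sup_le fun ab _ => ?_)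
    refine (totalDegree_mul _ _).trans ?_
    rw [map_add, mul_add]
    exact add_le_add (hs _ _) (ht _ _)
  | single i n =>
    induction n generalizing a j with
    | zero =>
      rw [Finsupp.single_zero, show monomial (0 : σ →₀ ℕ) a = C a from rfl, power_C]
      split_ifs <;> simp
    | succ n ih =>
      rw [show monomial (Finsupp.single i (n + 1)) a = monomial (Finsupp.single i n) a * X i by
        rw [X, monomial_mul, mul_one, ← Finsupp.single_add], power_mul]
      refine (totalDegree_finsetSum _ _).trans (Finset.sup_le fun ab _ => ?_)
      refine (totalDegree_mul _ _).trans ?_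
      have h2 : (power p σ ab.2 (X i)).totalDegree ≤ p := by
        rw [power_X]
        split_ifs
        · simpa using hp
        · simp
        · simp
      have h1 := ih a ab.1
      rw [Finsupp.degree_single] at h1 ⊢
      rw [mul_add, mul_one]
      exact add_le_add h1 h2

theorem totalDegree_power_le {p : ℕ} [Fact p.Prime] {σ : Type} (j : ℕ) (f : HBT p σ) :
    (power p σ j f).totalDegree ≤ p * f.totalDegree := by
  conv_lhs => rw [f.as_sum, map_sum]
  refine (totalDegree_finsetSum _ _).trans (Finset.sup_le fun s hs => ?_)
  refine (totalDegree_power_monomial_le s _ j).trans (Nat.mul_le_mul_left p ?_)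
  exact le_totalDegree hs

/-- The restriction `H^*(BT^{n+1}; Z_p) → H^*(BT^n; Z_p)`, setting the last variable to zero. -/
def restrict (p n : ℕ) : HBT p (Fin (n + 1)) →ₐ[ZMod p] HBT p (Fin n) :=
  aeval (Fin.lastCases (0 : HBT p (Fin n)) (fun i => X i))

theorem restrict_X (p n : ℕ) (i : Fin (n + 1)) :
    restrict p n (X i) = 0 ∨ ∃ l, restrict p n (X i) = X l := by
  refine Fin.lastCases ?_ (fun l => ?_) i
  · left; simp [restrict]
  · right; exact ⟨l, by simp [restrict]⟩

theorem restrict_esymm (p n k : ℕ) :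
    restrict p n (esymm (Fin (n + 1)) (ZMod p) k) = esymm (Fin n) (ZMod p) k := by
  have cons0 : ∀ (s : Multiset (HBT p (Fin n))), ((0 : HBT p (Fin n)) ::ₘ s).esymm k
      = s.esymm k := by
    intro s
    cases k with
    | zero => simp [Multiset.esymm]
    | succ k => simp [Multiset.esymm, Multiset.powersetCard_cons]
  rw [restrict, aeval_esymm_eq_multiset_esymm, esymm_eq_multiset_esymm,
    Fin.univ_castSuccEmb, Finset.cons_val, Multiset.map_cons, Fin.lastCases_last, cons0,
    Finset.map_val, Multiset.map_map]
  congr 2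
  funext i
  simp

/-- `H^*(BU(n); Z_p)`: the symmetric polynomials in `n` variables. -/
abbrev HBUn (p n : ℕ) : Subalgebra (ZMod p) (HBT p (Fin n)) :=
  symmetricSubalgebra (Fin n) (ZMod p)

/-- The Chern class `c_k ∈ H^{2k}(BU(n); Z_p)`. -/
def chernUn (p n k : ℕ) : HBUn p n := ⟨esymm (Fin n) (ZMod p) k, esymm_isSymmetric _ _ k⟩

/-- The Steenrod power `P^j` on `H^*(BU(n); Z_p)`. -/
def steenrodUn (p : ℕ) [Fact p.Prime] (n j : ℕ) : HBUn p n →ₗ[ZMod p] HBUn p n :=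
  ((power p (Fin n) j) ∘ₗ (HBUn p n).val.toLinearMap).codRestrict
    (Subalgebra.toSubmodule (HBUn p n)) fun f => power_isSymmetric j f.2

/-- `H^*(BU; Z_p)`: the families of symmetric polynomials `f_n ∈ Z_p[x_1, ..., x_n]` of bounded
degree with `f_{n+1}(x_1, ..., x_n, 0) = f_n`. -/
def HBU (p : ℕ) : Subalgebra (ZMod p) (∀ n : ℕ, HBT p (Fin n)) where
  carrier := {f | (∀ n, (f n).IsSymmetric) ∧ (∀ n, restrict p n (f (n + 1)) = f n) ∧
    ∃ N : ℕ, ∀ n, (f n).totalDegree ≤ N}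
  mul_mem' := by
    rintro f g ⟨hf, hf', N, hN⟩ ⟨hg, hg', M, hM⟩
    exact ⟨fun n => (hf n).mul (hg n), fun n => by simp [hf', hg'], N + M,
      fun n => (totalDegree_mul _ _).trans (add_le_add (hN n) (hM n))⟩
  add_mem' := by
    rintro f g ⟨hf, hf', N, hN⟩ ⟨hg, hg', M, hM⟩
    exact ⟨fun n => (hf n).add (hg n), fun n => by simp [hf', hg'], max N M,
      fun n => (totalDegree_add _ _).trans (max_le_max (hN n) (hM n))⟩
  algebraMap_mem' a :=
    ⟨fun n => IsSymmetric.C a, fun n => (restrict p n).commutes a, 0,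
      fun n => (totalDegree_C a).le⟩

/-- The universal Chern class `c_k ∈ H^{2k}(BU; Z_p)`. -/
def chern (p k : ℕ) : HBU p :=
  ⟨fun n => esymm (Fin n) (ZMod p) k, fun _ => esymm_isSymmetric _ _ k,
    fun n => restrict_esymm p n k, k, fun n => by
      simp only [MvPolynomial.esymm]
      refine (totalDegree_finsetSum _ _).trans (Finset.sup_le fun s hs => ?_)
      refine (totalDegree_finsetProd _ _).trans ?_
      rw [← (Finset.mem_powersetCard.1 hs).2, Finset.card_eq_sum_ones]
      exact Finset.sum_le_sum fun i _ => (totalDegree_monomial_le _ _).trans (by simp)⟩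

/-- The Steenrod power `P^j : H^*(BU; Z_p) → H^{* + 2(p-1)j}(BU; Z_p)`. -/
def steenrod (p : ℕ) [Fact p.Prime] (j : ℕ) : HBU p →ₗ[ZMod p] HBU p where
  toFun f := ⟨fun n => power p (Fin n) j (f.1 n), fun n => power_isSymmetric j (f.2.1 n),
    fun n => by rw [power_comm _ (restrict_X p n), f.2.2.1 n], by
      obtain ⟨N, hN⟩ := f.2.2.2
      exact ⟨p * N, fun n => (totalDegree_power_le j _).trans (Nat.mul_le_mul_left p (hN n))⟩⟩
  map_add' f g := by ext1; funext n; exact map_add _ _ _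
  map_smul' a f := by ext1; funext n; exact (power p (Fin n) j).map_smul a (f.1 n)

/-- The span of the products `c_{j_1} ⋯ c_{j_r}` with all `1 ≤ j_s < k` and
`j_1 + ⋯ + j_r = k`: the sums of products, of total degree `2k`, of Chern classes of degree less
than `2k`. -/
def lowerProducts (p : ℕ) {A : Type} [CommRing A] [Algebra (ZMod p) A] (c : ℕ → A) (k : ℕ) :
    Submodule (ZMod p) A :=
  Submodule.span (ZMod p)
    {y | ∃ s : Multiset ℕ, (∀ j ∈ s, 1 ≤ j ∧ j < k) ∧ s.sum = k ∧ y = (s.map c).prod}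

end

end CohomologyBU

/-! The total Steenrod power turns `∏ (1 + x_i u)` into `∏ (1 + x_i u + t x_i ^ p u ^ p)`, once `t`
is replaced by `t u ^ (p - 1)` to keep degrees aligned. This operation is a norm, `f(u) ↦ det f(u
M)` with `det (1 + z M) = 1 + z + t z ^ p`. The norm makes sense for every power series, is
multiplicative and commutes with ring maps. Applied to the formal series `∑ c_l u ^ l` it therefore
yields universal polynomials for `P^j(c_m)` without factoring into roots
(`seriesNorm_mem_weightedSeries`, `aeval_steenrodPoly`).

The coefficient of `c_k` in such a polynomial can be read off in any ring where products of the
classes vanish. Over the dual numbers take the total class `1 + ε u / (1 + u) = (1 + (1 + ε) u) / (1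
+ u)`. Since `(1 + ε) ^ p = 1`, its norm is `1 + ε u / (1 + u + t u ^ p)`, and expanding gives `± (m
- 1).choose j` (`coeff_steenrodPoly`). Lucas' theorem shows that this is nonzero mod `p` in both
cases. The relation is established among formal Chern classes, so one scalar serves `BU` and every
`BU(n)`. -/

namespace CohomologyBU

open MvPolynomial

noncomputable section

/-! ### The norm `f ↦ det f(u M)` on power series -/

/-- A companion matrix `M` with `det (1 + z M) = 1 + z + t z ^ (n + 1)`. -/
def companion {S : Type*} [CommRing S] (n : ℕ) (t : S) :
    Matrix (Fin (n + 1)) (Fin (n + 1)) S :=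
  Matrix.of fun a b =>
    if a = Fin.last n then
      if b = 0 then (-1) ^ n * t else if b = Fin.last n then 1 else 0
    else if (b : ℕ) = a + 1 then 1 else 0

/-- Expansion along column `0`: only the top and bottom rows contribute, with triangular minors `1 +
z` and a power of `z`; the sign in the corner of `M` cancels the cofactor sign. For `n = 0` the two
special entries of the last row collide and the formula fails. -/
theorem det_one_add_smul_companion {S : Type*} [CommRing S] {n : ℕ} (hn : n ≠ 0) (z t : S) :
    (1 + z • companion n t).det = 1 + z + t * z ^ (n + 1) := by
  obtain ⟨n, rfl⟩ := Nat.exists_eq_succ_of_ne_zero hn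
  have h0 : ((1 + z • companion (n + 1) t).submatrix (Fin.succAbove 0) Fin.succ).det
      = 1 + z := by
    rw [Matrix.det_of_isUpperTriangular, Fin.prod_univ_castSucc]
    · rw [Finset.prod_eq_one]
      · simp [companion]
      · intro i _
        have : i.castSucc.succ ≠ Fin.last (n + 1) := by
          simp [Fin.ext_iff, Fin.val_last]; omega
        simp [companion, this]
    · intro a b hab
      have hab' : (b : ℕ) < a := hab
      have h1 : a.succ ≠ b.succ := by simp [Fin.ext_iff]; omega
      have h2 : b.succ ≠ Fin.last (n + 1) := by simp [Fin.ext_iff]; omega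
      have h3 : ¬ (b : ℕ) = a + 1 := by omega
      simp [companion, h1, h2, h3]
  have h1 : ((1 + z • companion (n + 1) t).submatrix (Fin.succAbove (Fin.last (n + 1)))
      Fin.succ).det = z ^ (n + 1) := by
    rw [Matrix.det_of_isLowerTriangular]
    · rw [Finset.prod_eq_pow_card (b := z)]
      · simp
      · intro i _
        have h1 : i.castSucc ≠ i.succ := by simp [Fin.ext_iff]
        have h2 : i.castSucc ≠ Fin.last (n + 1) := by simp [Fin.ext_iff]; omega
        simp [companion, h1, h2]
    · intro a b hab
      have hab' : (a : ℕ) < b := hab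
      have h1 : a.castSucc ≠ b.succ := by simp [Fin.ext_iff]; omega
      have h2 : a.castSucc ≠ Fin.last (n + 1) := by simp [Fin.ext_iff]; omega
      have h3 : ¬ (b : ℕ) = a := by omega
      simp [companion, h1, h2, h3]
  rw [Matrix.det_succ_column_zero, Fin.sum_univ_succ, Fin.sum_univ_castSucc, Finset.sum_eq_zero]
  · rw [h0, Fin.succ_last, h1]
    have h2 : (0 : Fin (n + 2)) ≠ Fin.last (n + 1) := by simp [Fin.ext_iff]
    have h3 : (-1 : S) ^ (n + 1) * (-1) ^ (n + 1) = 1 := by rw [← mul_pow]; simp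
    simp [companion, h2, h2.symm]
    linear_combination (t * z * z ^ (n + 1)) * h3
  · intro i _
    have h2 : i.castSucc.succ ≠ Fin.last (n + 1) := by simp [Fin.ext_iff]; omega
    simp [companion, h2]

theorem companion_map {S T : Type*} [CommRing S] [CommRing T] (φ : S →+* T) (n : ℕ) (t : S) :
    φ.mapMatrix (companion n t) = companion n (φ t) := by
  ext a b
  simp only [RingHom.mapMatrix_apply, Matrix.map_apply, companion, Matrix.of_apply]
  split_ifs <;> simp

/-- The matrix `f(u M)`, where `M` is the companion matrix over `A[t]` and `u` is the power series
variable. -/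
def seriesMatrix {A : Type*} [CommRing A] (n : ℕ) (f : PowerSeries A) :
    Matrix (Fin (n + 1)) (Fin (n + 1)) (PowerSeries (Polynomial A)) :=
  Matrix.of fun a b => PowerSeries.mk fun l =>
    Polynomial.C (PowerSeries.coeff l f) * (companion n (Polynomial.X : Polynomial A) ^ l) a b

/-- Evaluation at `u M` is multiplicative because scalars commute with powers of `M`;
coefficientwise this is `M ^ (q + r) = M ^ q * M ^ r`. -/
theorem seriesMatrix_mul {A : Type*} [CommRing A] (n : ℕ) (f g : PowerSeries A) :
    seriesMatrix n (f * g) = seriesMatrix n f * seriesMatrix n g := by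
  ext1 a b
  ext1 l
  simp only [seriesMatrix, Matrix.of_apply, PowerSeries.coeff_mk, Matrix.mul_apply, map_sum,
    PowerSeries.coeff_mul]
  rw [Finset.sum_comm, Finset.sum_mul]
  refine Finset.sum_congr rfl fun qr hqr => ?_
  rw [← Finset.HasAntidiagonal.mem_antidiagonal.1 hqr, pow_add, Matrix.mul_apply, Finset.mul_sum]
  refine Finset.sum_congr rfl fun c _ => ?_
  rw [map_mul]
  ring

theorem seriesMatrix_one {A : Type*} [CommRing A] (n : ℕ) :
    seriesMatrix n (1 : PowerSeries A) = 1 := by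
  ext1 a b
  ext1 l
  rcases eq_or_ne a b with rfl | h <;> rcases l with _ | l <;>
    simp [seriesMatrix, PowerSeries.coeff_one, *]

theorem seriesMatrix_one_add {A : Type*} [CommRing A] (n : ℕ) (x : A) :
    seriesMatrix n (1 + PowerSeries.C x * PowerSeries.X) =
      1 + (PowerSeries.C (Polynomial.C x) * PowerSeries.X) •
        companion n (PowerSeries.C (Polynomial.X : Polynomial A)) := by
  rw [← companion_map]
  ext1 a b
  ext1 l
  rcases eq_or_ne a b with rfl | h <;> rcases l with _ | _ | l <;>
    simp [seriesMatrix, PowerSeries.coeff_one, mul_assoc, PowerSeries.coeff_X, *]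

/-- The multiplicative map `f ↦ det f(u M)` on power series, which sends `1 + x u` to
`1 + x u + t (x u) ^ (n + 1)`. -/
def seriesNorm {A : Type*} [CommRing A] (n : ℕ) : PowerSeries A →* PowerSeries (Polynomial A) where
  toFun f := (seriesMatrix n f).det
  map_one' := by rw [seriesMatrix_one, Matrix.det_one]
  map_mul' f g := by rw [seriesMatrix_mul, Matrix.det_mul]

theorem seriesNorm_one_add {A : Type*} [CommRing A] {n : ℕ} (hn : n ≠ 0) (x : A) :
    seriesNorm n (1 + PowerSeries.C x * PowerSeries.X) =
      1 + PowerSeries.C (Polynomial.C x) * PowerSeries.X +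
        PowerSeries.C (Polynomial.X * Polynomial.C (x ^ (n + 1))) * PowerSeries.X ^ (n + 1) := by
  change (seriesMatrix n _).det = _
  rw [seriesMatrix_one_add, det_one_add_smul_companion hn]
  simp only [map_mul, map_pow]
  ring

/-- Base change is what allows the norm of the formal Chern series to be specialised both to
symmetric polynomials and to dual numbers. -/
theorem seriesNorm_map {A B : Type*} [CommRing A] [CommRing B] (φ : A →+* B) (n : ℕ)
    (f : PowerSeries A) :
    seriesNorm n (PowerSeries.map φ f) =
      PowerSeries.map (Polynomial.mapRingHom φ) (seriesNorm n f) := by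
  change (seriesMatrix n _).det = PowerSeries.map (Polynomial.mapRingHom φ) (seriesMatrix n f).det
  rw [RingHom.map_det]
  congr 1
  ext1 a b
  ext1 l
  have h : (companion n (Polynomial.X : Polynomial B) ^ l) a b =
      Polynomial.mapRingHom φ ((companion n (Polynomial.X : Polynomial A) ^ l) a b) := by
    have := companion_map (Polynomial.mapRingHom φ) n (Polynomial.X : Polynomial A)
    rw [Polynomial.coe_mapRingHom, Polynomial.map_X] at this
    rw [← this, ← map_pow]
    rfl
  simp [seriesMatrix, h]

/-! ### Formal Chern classes, weights and decomposables -/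

theorem lowerProducts_map (p : ℕ) {A B : Type} [CommRing A] [CommRing B] [Algebra (ZMod p) A]
    [Algebra (ZMod p) B] (φ : A →ₐ[ZMod p] B) {c : ℕ → A} {d : ℕ → B}
    (h : ∀ j, φ (c j) = d j) (k : ℕ) {x : A} (hx : x ∈ lowerProducts p c k) :
    φ x ∈ lowerProducts p d k := by
  have : lowerProducts p c k ≤ (lowerProducts p d k).comap φ.toLinearMap := by
    refine Submodule.span_le.2 ?_
    rintro y ⟨s, hs, hk, rfl⟩
    refine Submodule.subset_span ⟨s, hs, hk, ?_⟩
    change φ _ = _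
    rw [map_multiset_prod, Multiset.map_map]
    congr 2
    funext j
    exact h j
  exact this hx

/-- If all pairwise products of the classes vanish, then so do the products of lower degree. -/
theorem eq_zero_of_mem_lowerProducts (p : ℕ) {A : Type} [CommRing A] [Algebra (ZMod p) A]
    {c : ℕ → A} (h : ∀ i j, 1 ≤ i → 1 ≤ j → c i * c j = 0) {k : ℕ} (hk : k ≠ 0) {x : A}
    (hx : x ∈ lowerProducts p c k) : x = 0 := by
  have : lowerProducts p c k ≤ ⊥ := by
    refine Submodule.span_le.2 ?_
    rintro y ⟨s, hs, hsk, rfl⟩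
    obtain ⟨a, ha⟩ : ∃ a, a ∈ s := by
      by_contra! hne
      rw [Multiset.eq_zero_of_forall_notMem hne] at hsk
      simp at hsk
      exact hk hsk.symm
    obtain ⟨s, rfl⟩ := Multiset.exists_cons_of_mem ha
    obtain ⟨b, hb⟩ : ∃ b, b ∈ s := by
      by_contra! hne
      rw [Multiset.eq_zero_of_forall_notMem hne] at hsk
      have := (hs a ha).2
      simp at hsk
      omega
    obtain ⟨s, rfl⟩ := Multiset.exists_cons_of_mem hb
    have := h a b (hs a ha).1 (hs b (by simp)).1
    simp [← mul_assoc, this]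
  simpa using this hx

/-- The ring of polynomials in Chern classes; the variable `X l` stands for `c_{l+1}`. -/
abbrev ChernRing (p : ℕ) : Type := MvPolynomial ℕ (ZMod p)

/-- The formal Chern class `c_k`. -/
def formalChern (p : ℕ) : ℕ → ChernRing p
  | 0 => 1
  | l + 1 => X l

theorem formalChern_isWeightedHomogeneous (p k : ℕ) :
    IsWeightedHomogeneous (fun l : ℕ => l + 1) (formalChern p k) k := by
  cases k with
  | zero => exact isWeightedHomogeneous_one _ _
  | succ k => exact isWeightedHomogeneous_X _ _ k

theorem monomial_eq_prod_toMultiset {R : Type*} [CommSemiring R] {σ : Type*} (s : σ →₀ ℕ) :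
    monomial s (1 : R) = (s.toMultiset.map X).prod := by
  rw [monomial_eq, C_1, one_mul]
  induction s using Finsupp.induction_linear with
  | zero => simp
  | add s t hs ht =>
    rw [Finsupp.prod_add_index' (by simp) (by simp [pow_add]), hs, ht, map_add, Multiset.map_add,
      Multiset.prod_add]
  | single i n => simp [Finsupp.toMultiset_single, Multiset.map_nsmul, Multiset.prod_nsmul]

theorem sum_map_toMultiset {σ : Type*} (w : σ → ℕ) (s : σ →₀ ℕ) :
    (s.toMultiset.map w).sum = Finsupp.weight w s := by
  induction s using Finsupp.induction_linear with
  | zero => simp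
  | add s t hs ht => rw [map_add, Multiset.map_add, Multiset.sum_add, hs, ht, map_add]
  | single i n =>
    simp [Finsupp.toMultiset_single, Multiset.map_nsmul, Multiset.sum_nsmul, Finsupp.weight_single]

/-- The variable `X k` already has the full weight `k + 1`, so a monomial of that weight containing
it equals `X k`; every other monomial is a product of lower classes. -/
theorem sub_mem_lowerProducts (p k : ℕ) (q : ChernRing p)
    (hq : IsWeightedHomogeneous (fun l : ℕ => l + 1) q (k + 1)) :
    q - coeff (Finsupp.single k 1) q • formalChern p (k + 1) ∈
      lowerProducts p (formalChern p) (k + 1) := by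
  classical
  have key : q - coeff (Finsupp.single k 1) q • formalChern p (k + 1) =
      ∑ s ∈ q.support.erase (Finsupp.single k 1), monomial s (coeff s q) := by
    rw [sub_eq_iff_eq_add]
    conv_lhs => rw [q.as_sum]
    by_cases h : Finsupp.single k 1 ∈ q.support
    · rw [← Finset.sum_erase_add _ _ h]
      congr 1
      simp [formalChern, X, smul_monomial]
    · rw [Finset.erase_eq_of_notMem h, notMem_support_iff.1 h, zero_smul, add_zero]
  rw [key]
  refine Submodule.sum_mem _ fun s hs => ?_
  obtain ⟨hne, hs⟩ := Finset.mem_erase.1 hs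
  have hw : (s.toMultiset.map (· + 1)).sum = k + 1 := by
    rw [sum_map_toMultiset]
    exact hq (mem_support_iff.1 hs)
  have hmon : monomial s (coeff s q) =
      coeff s q • ((s.toMultiset.map (· + 1)).map (formalChern p)).prod := by
    rw [Multiset.map_map, ← mul_one (coeff s q), ← smul_eq_mul, ← smul_monomial, smul_eq_mul,
      mul_one]
    congr 1
    exact monomial_eq_prod_toMultiset s
  rw [hmon]
  refine Submodule.smul_mem _ _ (Submodule.subset_span ⟨_, fun j hj => ?_, hw, rfl⟩)
  obtain ⟨l, hl, rfl⟩ := Multiset.mem_map.1 hj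
  refine ⟨Nat.succ_pos l, lt_of_le_of_ne (hw ▸ Multiset.single_le_sum (by simp) _ hj) ?_⟩
  intro hlk
  obtain rfl : l = k := Nat.succ_injective hlk
  apply hne
  obtain ⟨t, ht⟩ := Multiset.exists_cons_of_mem hl
  have ht0 : t = 0 := by
    refine Multiset.eq_zero_of_forall_notMem fun a ha => ?_
    obtain ⟨t, rfl⟩ := Multiset.exists_cons_of_mem ha
    rw [ht] at hw
    simp at hw
  rw [ht0] at ht
  apply Multiset.toFinsupp.symm.injective
  change Finsupp.toMultiset s = Finsupp.toMultiset _
  rw [ht, Finsupp.toMultiset_single, one_smul]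
  rfl

/-- A series over `ChernRing p [t]` whose coefficient of `u ^ k` has weight `k`. -/
def weightedSeries (p : ℕ) : Subring (PowerSeries (Polynomial (ChernRing p))) where
  carrier := {f | ∀ k j, IsWeightedHomogeneous (fun l : ℕ => l + 1)
    ((PowerSeries.coeff k f).coeff j) k}
  mul_mem' {f g} hf hg k j := by
    rw [PowerSeries.coeff_mul, Polynomial.finsetSum_coeff]
    refine Submodule.sum_mem (weightedHomogeneousSubmodule _ _ _) fun ab hab => ?_
    rw [Polynomial.coeff_mul]
    refine Submodule.sum_mem (weightedHomogeneousSubmodule _ _ _) fun cd _ => ?_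
    rw [← Finset.HasAntidiagonal.mem_antidiagonal.1 hab]
    exact (hf _ _).mul (hg _ _)
  one_mem' k j := by
    rw [PowerSeries.coeff_one]
    split_ifs with h
    · subst h
      rw [Polynomial.coeff_one]
      split_ifs
      · exact isWeightedHomogeneous_one _ _
      · exact isWeightedHomogeneous_zero _ _ _
    · exact isWeightedHomogeneous_zero _ _ _
  zero_mem' k j := by simpa using isWeightedHomogeneous_zero _ _ _
  add_mem' {f g} hf hg k j := by simpa using (hf k j).add (hg k j)
  neg_mem' {f} hf k j := by
    rw [map_neg, Polynomial.coeff_neg]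
    exact Submodule.neg_mem
      (weightedHomogeneousSubmodule (ZMod p) (fun l : ℕ => l + 1) k) (hf k j)

/-- The formal total Chern class `∑ c_k u ^ k`. -/
def formalChernSeries (p : ℕ) : PowerSeries (ChernRing p) := PowerSeries.mk (formalChern p)

/-- Used with `S = ZMod p`: the entries of `M ^ l` have scalar coefficients, hence do not affect
weights. -/
theorem companion_pow_coeff (S : Type*) [CommRing S] (n l : ℕ) (a b : Fin (n + 1)) (R : Type*)
    [CommRing R] [Algebra S R] :
    (companion n (Polynomial.X : Polynomial R) ^ l) a b =
      Polynomial.map (algebraMap S R) ((companion n (Polynomial.X : Polynomial S) ^ l) a b) := by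
  have := companion_map (Polynomial.mapRingHom (algebraMap S R)) n (Polynomial.X : Polynomial S)
  rw [Polynomial.coe_mapRingHom, Polynomial.map_X] at this
  rw [← this, ← map_pow]
  rfl

theorem seriesNorm_mem_weightedSeries (p n : ℕ) :
    seriesNorm n (formalChernSeries p) ∈ weightedSeries p := by
  change (seriesMatrix n _).det ∈ _
  rw [Matrix.det_apply]
  refine Subring.sum_mem _ fun σ _ => ?_
  rw [Units.smul_def]
  refine Subring.zsmul_mem _ (Subring.prod_mem _ fun a _ => ?_) _
  intro k j
  rw [seriesMatrix, Matrix.of_apply, PowerSeries.coeff_mk, companion_pow_coeff (ZMod p),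
    Polynomial.coeff_C_mul, Polynomial.coeff_map, formalChernSeries, PowerSeries.coeff_mk,
    ← Algebra.commutes, ← Algebra.smul_def]
  exact Submodule.smul_mem (weightedHomogeneousSubmodule _ _ _) _
    (formalChern_isWeightedHomogeneous p k)

/-- The polynomial in the Chern classes that gives `P^j(c_m)`, where `k = m + (p - 1) j`. -/
def steenrodPoly (p k j : ℕ) : ChernRing p :=
  (PowerSeries.coeff k (seriesNorm (p - 1) (formalChernSeries p))).coeff j

theorem map_steenrodPoly (p : ℕ) {A : Type*} [CommRing A] (φ : ChernRing p →+* A) (k j : ℕ) :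
    φ (steenrodPoly p k j) = (PowerSeries.coeff k (seriesNorm (p - 1)
      (PowerSeries.mk fun l => φ (formalChern p l)))).coeff j := by
  have : (PowerSeries.mk fun l => φ (formalChern p l)) =
      PowerSeries.map φ (formalChernSeries p) := by
    ext l
    simp [formalChernSeries]
  rw [this, seriesNorm_map]
  simp [steenrodPoly]

/-! ### The coefficient of `c_k`, computed over the dual numbers -/

/-- The coefficients of the inverse of `1 + u + t u ^ p`. -/
theorem coeff_coeff_of_mul_eq_one {A : Type*} [CommRing A] {p : ℕ} (hp : 2 ≤ p)
    {G : PowerSeries (Polynomial A)}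
    (hG : G * (1 + PowerSeries.X + PowerSeries.C Polynomial.X * PowerSeries.X ^ p) = 1)
    (n j : ℕ) : (PowerSeries.coeff n G).coeff j =
      if (p - 1) * j ≤ n then
        (-1) ^ (n - (p - 1) * j) * ((n - (p - 1) * j).choose j : A) else 0 := by
  -- Comparing coefficients gives the recursion `G_n = -G_(n-1) - t G_(n-p)`, which becomes Pascal's
  -- rule; the remaining cases are boundary cases where terms vanish.
  have hG' : G + G * PowerSeries.X + PowerSeries.C Polynomial.X * (G * PowerSeries.X ^ p) = 1 := by
    rw [← hG]; ring
  induction n using Nat.strong_induction_on generalizing j with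
  | _ n ih =>
    have h := congrArg (fun f => (PowerSeries.coeff n f).coeff j) hG'
    simp only [map_add, Polynomial.coeff_add, PowerSeries.coeff_C_mul,
      PowerSeries.coeff_mul_X_pow'] at h
    rcases n with _ | n
    · have hp0 : ¬ p ≤ 0 := by omega
      simp [PowerSeries.coeff_zero_mul_X, hp0] at h
      rcases j with _ | j
      · simpa using h
      · have : ¬ (p - 1 = 0) := by omega
        simpa [this, Polynomial.coeff_one] using h
    · rw [PowerSeries.coeff_succ_mul_X, ih n (by omega), PowerSeries.coeff_one] at h
      simp only [Nat.succ_ne_zero, if_false, Polynomial.coeff_zero] at h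
      rcases j with _ | j
      · simp at h ⊢
        rw [apply_ite (Polynomial.coeff · 0)] at h
        simp at h
        rw [pow_succ]
        linear_combination h
      · rw [Polynomial.coeff_X_mul] at h
        have hpj : (p - 1) * (j + 1) = (p - 1) * j + (p - 1) := by ring
        by_cases hpn : p ≤ n + 1
        · rw [if_pos hpn, ih (n + 1 - p) (by omega)] at h
          rcases lt_trichotomy ((p - 1) * (j + 1)) (n + 1) with hlt | heq | hgt
          · rw [if_pos (by omega), if_pos (by omega)] at h
            rw [if_pos hlt.le]
            have e1 : n + 1 - (p - 1) * (j + 1) = (n - (p - 1) * (j + 1)) + 1 := by omega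
            have e2 : n + 1 - p - (p - 1) * j = n - (p - 1) * (j + 1) := by omega
            rw [e2] at h
            rw [e1, Nat.choose_succ_succ, pow_succ]
            push_cast
            linear_combination h
          · rw [if_neg (by omega), if_neg (by omega)] at h
            simp [heq] at h ⊢
            exact h
          · rw [if_neg (by omega), if_neg (by omega)] at h
            rw [if_neg (by omega)]
            simpa using h
        · have hj : (j = 0 ∧ n + 1 = p - 1) ∨ n + 1 < (p - 1) * (j + 1) := by
            rcases j with _ | j
            · omega
            · right
              have : (p - 1) * (j + 1 + 1) = (p - 1) * j + (p - 1) + (p - 1) := by ring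
              omega
          rw [if_neg hpn] at h
          rcases hj with ⟨rfl, hj⟩ | hj
          · rw [if_neg (by omega)] at h
            simpa [hj] using h
          · rw [if_neg (by omega)] at h
            rw [if_neg (by omega)]
            simpa using h

/-- The specialisation of the Chern classes with total class `1 + ε u / (1 + u)`. -/
def toDual (p : ℕ) : ChernRing p →ₐ[ZMod p] DualNumber (ZMod p) :=
  aeval fun l => ((-1) ^ l : ZMod p) • DualNumber.eps

/-- This writes the total class as a quotient of two linear factors, on which the norm is known. -/
theorem toDual_series (p : ℕ) :
    (PowerSeries.mk fun l => toDual p (formalChern p l)) *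
        (1 + PowerSeries.C 1 * PowerSeries.X) =
      1 + PowerSeries.C (1 + DualNumber.eps) * PowerSeries.X := by
  rw [map_one, one_mul, mul_add, mul_one]
  ext1 l
  rcases l with _ | _ | l
  · simp [formalChern]
  · simp [formalChern, toDual, PowerSeries.coeff_one, add_comm]
  · simp [formalChern, toDual, PowerSeries.coeff_one,
      PowerSeries.coeff_succ_mul_X, pow_succ]

/-- In characteristic `p`, `(1 + ε) ^ p = 1 + ε ^ p = 1`, so the norms of numerator and denominator
differ only by `ε u`. -/
theorem seriesNorm_toDual_series (p : ℕ) [Fact p.Prime]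
    {G : PowerSeries (Polynomial (DualNumber (ZMod p)))}
    (hG : G * (1 + PowerSeries.X + PowerSeries.C Polynomial.X * PowerSeries.X ^ p) = 1) :
    seriesNorm (p - 1) (PowerSeries.mk fun l => toDual p (formalChern p l)) =
      1 + PowerSeries.C (Polynomial.C DualNumber.eps) * (G * PowerSeries.X) := by
  have hp := (Fact.out : p.Prime).two_le
  have hp1 : p - 1 + 1 = p := by omega
  have : CharP (DualNumber (ZMod p)) p :=
    charP_of_injective_algebraMap
      (algebraMap (ZMod p) (DualNumber (ZMod p))).injective p
  have h := congrArg (seriesNorm (p - 1)) (toDual_series p)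
  have hpow : (1 + DualNumber.eps : DualNumber (ZMod p)) ^ p = 1 := by
    rw [add_pow_char, one_pow, pow_eq_zero_of_le hp (by rw [pow_two, DualNumber.eps_mul_eps]),
      add_zero]
  rw [map_mul, seriesNorm_one_add (by omega), seriesNorm_one_add (by omega), hp1, hpow] at h
  simp only [one_pow, map_one, one_mul, mul_one, map_add] at h
  linear_combination G * h - (seriesNorm (p - 1)
    (PowerSeries.mk fun l => toDual p (formalChern p l)) - 1) * hG

theorem exists_mul_eq_one {A : Type*} [CommRing A] {p : ℕ} (hp : p ≠ 0) :
    ∃ G : PowerSeries (Polynomial A),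
      G * (1 + PowerSeries.X + PowerSeries.C Polynomial.X * PowerSeries.X ^ p) = 1 := by
  refine ⟨PowerSeries.invOfUnit
    (1 + PowerSeries.X + PowerSeries.C Polynomial.X * PowerSeries.X ^ p) 1, ?_⟩
  rw [mul_comm]
  apply PowerSeries.mul_invOfUnit
  simp [hp]

/-- The coefficient of `c_k` in `P^j(c_{q+1})`, where `k = q + 1 + (p - 1) j`. -/
theorem coeff_steenrodPoly (p : ℕ) [Fact p.Prime] (q j : ℕ) :
    coeff (Finsupp.single (q + (p - 1) * j) 1) (steenrodPoly p (q + (p - 1) * j + 1) j) *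
      (-1) ^ (q + (p - 1) * j) = (-1) ^ q * (q.choose j : ZMod p) := by
  obtain ⟨G, hG⟩ : ∃ G : PowerSeries (Polynomial (DualNumber (ZMod p))),
      G * (1 + PowerSeries.X + PowerSeries.C Polynomial.X * PowerSeries.X ^ p) = 1 :=
    exists_mul_eq_one (Fact.out : p.Prime).ne_zero
  set k := q + (p - 1) * j with hk
  have h1 := lowerProducts_map p (toDual p) (d := fun l => toDual p (formalChern p l))
    (fun _ => rfl) _ (sub_mem_lowerProducts p k _
      (seriesNorm_mem_weightedSeries p (p - 1) (k + 1) j))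
  -- All classes are multiples of `ε`, so decomposables die and only the `c_k` term survives.
  have h2 := eq_zero_of_mem_lowerProducts p (fun a b ha hb => by
    obtain ⟨a, rfl⟩ := Nat.exists_eq_add_of_le' ha
    obtain ⟨b, rfl⟩ := Nat.exists_eq_add_of_le' hb
    simp [formalChern, toDual]) k.succ_ne_zero h1
  have h3 := map_steenrodPoly p (toDual p : ChernRing p →+* DualNumber (ZMod p)) (k + 1) j
  have h4 := coeff_coeff_of_mul_eq_one (Fact.out : p.Prime).two_le hG k j
  simp only [RingHom.coe_coe] at h3
  rw [seriesNorm_toDual_series p hG, map_add, PowerSeries.coeff_C_mul,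
    PowerSeries.coeff_succ_mul_X, Polynomial.coeff_add, Polynomial.coeff_C_mul, h4,
    if_pos (by omega), show k - (p - 1) * j = q by omega] at h3
  rw [map_sub, map_smul, sub_eq_zero] at h2
  -- Comparing `ε`-parts: `c_(k+1)` maps to `(-1) ^ k ε`, whence the sign on the left of the claim.
  have h5 := congrArg TrivSqZeroExt.snd (h2.symm.trans h3)
  have e1 : TrivSqZeroExt.snd ((-1 : DualNumber (ZMod p)) ^ q) = 0 := by
    rcases neg_one_pow_eq_or (DualNumber (ZMod p)) q with h | h <;> rw [h] <;> simp
  change coeff (Finsupp.single k 1)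
    ((PowerSeries.coeff (k + 1) (seriesNorm (p - 1) (formalChernSeries p))).coeff j) * _ = _
  simpa [formalChern, toDual, PowerSeries.coeff_one, e1] using h5

/-! ### The norm computes Steenrod powers of elementary symmetric polynomials -/

theorem prod_one_add_mul {A σ : Type*} [CommRing A] [Fintype σ] (y : σ → A) (z : A) :
    ∏ i, (1 + y i * z) = ∑ m ∈ Finset.range (Fintype.card σ + 1),
      (∑ s ∈ Finset.powersetCard m Finset.univ, ∏ i ∈ s, y i) * z ^ m := by
  rw [Finset.prod_one_add, Finset.sum_powerset, Finset.card_univ]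
  refine Finset.sum_congr rfl fun m _ => ?_
  rw [Finset.sum_mul]
  refine Finset.sum_congr rfl fun s hs => ?_
  rw [Finset.prod_mul_distrib, Finset.prod_const, (Finset.mem_powersetCard.1 hs).2]

theorem esymm_series (R : Type*) [CommRing R] (n : ℕ) :
    (PowerSeries.mk fun l => esymm (Fin n) R l) =
      ∏ i, (1 + PowerSeries.C (X i) * PowerSeries.X) := by
  rw [prod_one_add_mul]
  ext1 l
  have : ∀ m, (∑ s ∈ Finset.powersetCard m (Finset.univ : Finset (Fin n)),
      ∏ i ∈ s, PowerSeries.C (X i : MvPolynomial (Fin n) R)) =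
      PowerSeries.C (esymm (Fin n) R m) := by
    intro m
    simp [esymm]
  simp only [this, PowerSeries.coeff_mk, map_sum, PowerSeries.coeff_C_mul, PowerSeries.coeff_X_pow,
    Fintype.card_fin]
  simp only [mul_ite, mul_one, mul_zero, Finset.sum_ite_eq, Finset.mem_range]
  split_ifs with h
  · rfl
  · rw [esymm, Finset.powersetCard_eq_empty.2 (by simpa using h), Finset.sum_empty]

/-- The substitution `t ↦ t u ^ d`. -/
def substPow (A : Type*) [CommRing A] (d : ℕ) : Polynomial A →+* PowerSeries (Polynomial A) :=
  Polynomial.eval₂RingHom (PowerSeries.C.comp Polynomial.C)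
    (PowerSeries.C Polynomial.X * PowerSeries.X ^ d)

theorem coeff_coeff_substPow {A : Type*} [CommRing A] (d l j : ℕ) (f : Polynomial A) :
    (PowerSeries.coeff l (substPow A d f)).coeff j = if l = d * j then f.coeff j else 0 := by
  induction f using Polynomial.induction_on' with
  | add f g hf hg =>
    rw [map_add, map_add, Polynomial.coeff_add, hf, hg]
    split_ifs <;> simp
  | monomial r a =>
    have : substPow A d (Polynomial.monomial r a) =
        PowerSeries.C (Polynomial.monomial r a) * PowerSeries.X ^ (d * r) := by
      simp only [substPow, Polynomial.coe_eval₂RingHom, Polynomial.eval₂_monomial]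
      rw [mul_pow, ← pow_mul, ← Polynomial.C_mul_X_pow_eq_monomial]
      simp [mul_assoc]
    rw [this, PowerSeries.coeff_C_mul, PowerSeries.coeff_X_pow, Polynomial.coeff_monomial]
    by_cases h : r = j
    · subst h
      by_cases hl : l = d * r <;> simp [hl]
    · split_ifs <;> simp [Polynomial.coeff_monomial, h]

/-- Both sides are multiplicative over the factors `1 + x_i u`, and on one factor both give `1 +
(x_i + x_i ^ p t u ^ (p - 1)) u`. -/
theorem seriesNorm_esymm_series (p n : ℕ) [Fact p.Prime] :
    seriesNorm (p - 1) (PowerSeries.mk fun l => esymm (Fin n) (ZMod p) l) =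
      ∑ m ∈ Finset.range (n + 1),
        substPow (HBT p (Fin n)) (p - 1) (totalPower p (Fin n) (esymm (Fin n) (ZMod p) m)) *
          PowerSeries.X ^ m := by
  have hp := (Fact.out : p.Prime).two_le
  have hp1 : p - 1 + 1 = p := by omega
  have h : ∀ i : Fin n, seriesNorm (p - 1)
      (1 + PowerSeries.C (X i : HBT p (Fin n)) * PowerSeries.X) =
        1 + substPow _ (p - 1) (totalPower p (Fin n) (X i)) * PowerSeries.X := by
    intro i
    rw [seriesNorm_one_add (by omega), hp1]
    simp only [totalPower, aeval_X, substPow, map_add, map_mul, Polynomial.coe_eval₂RingHom,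
      Polynomial.eval₂_C, Polynomial.eval₂_X, RingHom.comp_apply]
    have hpow : (PowerSeries.X : PowerSeries (Polynomial (HBT p (Fin n)))) ^ p =
        PowerSeries.X ^ (p - 1) * PowerSeries.X := by rw [← pow_succ, hp1]
    rw [hpow]
    ring
  rw [esymm_series, map_prod, Finset.prod_congr rfl fun i _ => h i, prod_one_add_mul,
    Fintype.card_fin]
  simp [esymm]

theorem aeval_steenrodPoly (p n : ℕ) [Fact p.Prime] (m j : ℕ) :
    aeval (fun l => esymm (Fin n) (ZMod p) (l + 1)) (steenrodPoly p (m + (p - 1) * j) j) =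
      power p (Fin n) j (esymm (Fin n) (ZMod p) m) := by
  have h := map_steenrodPoly p (aeval (R := ZMod p)
    (fun l => esymm (Fin n) (ZMod p) (l + 1)) : ChernRing p →+* HBT p (Fin n)) (m + (p - 1) * j) j
  have hc : (fun l => (aeval (R := ZMod p)
      (fun l => esymm (Fin n) (ZMod p) (l + 1)) : ChernRing p →+* HBT p (Fin n))
      (formalChern p l)) = fun l => esymm (Fin n) (ZMod p) l := by
    funext l
    cases l <;> simp [formalChern]
  rw [hc, seriesNorm_esymm_series] at h
  rw [RingHom.coe_coe] at h
  rw [h, map_sum, Polynomial.finsetSum_coeff]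
  -- In summand `r`, `t ^ j` occurs only with `u ^ (r + (p - 1) j)`, which singles out `r = m`.
  have hterm : ∀ r, (PowerSeries.coeff (m + (p - 1) * j)
      (substPow (HBT p (Fin n)) (p - 1) (totalPower p (Fin n) (esymm (Fin n) (ZMod p) r)) *
        PowerSeries.X ^ r)).coeff j =
      if r = m then power p (Fin n) j (esymm (Fin n) (ZMod p) r) else 0 := by
    intro r
    rw [PowerSeries.coeff_mul_X_pow']
    by_cases hr : r ≤ m + (p - 1) * j
    · rw [if_pos hr, coeff_coeff_substPow, power_apply]
      congr 1
      apply propext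
      omega
    · rw [if_neg hr, if_neg (by omega), Polynomial.coeff_zero]
  simp only [hterm, Finset.sum_ite_eq', Finset.mem_range]
  split_ifs with hm
  · rfl
  · rw [esymm, Finset.powersetCard_eq_empty.2 (by simpa using hm), Finset.sum_empty, map_zero]

/-! ### Transfer to `BU` and `BU(n)` -/

/-- The homomorphism `ChernRing p → H^*(BU; Z_p)`. -/
def toHBU (p : ℕ) : ChernRing p →ₐ[ZMod p] HBU p := aeval fun l => chern p (l + 1)

/-- The homomorphism `ChernRing p → H^*(BU(n); Z_p)`. -/
def toHBUn (p n : ℕ) : ChernRing p →ₐ[ZMod p] HBUn p n := aeval fun l => chernUn p n (l + 1)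

theorem toHBU_formalChern (p k : ℕ) : toHBU p (formalChern p k) = chern p k := by
  cases k with
  | zero =>
    rw [formalChern, map_one]
    ext1
    funext n
    exact (esymm_zero (Fin n) (ZMod p)).symm
  | succ k => exact aeval_X _ _

theorem toHBUn_formalChern (p n k : ℕ) : toHBUn p n (formalChern p k) = chernUn p n k := by
  cases k with
  | zero =>
    rw [formalChern, map_one]
    ext1
    exact (esymm_zero (Fin n) (ZMod p)).symm
  | succ k => exact aeval_X _ _

theorem toHBUn_steenrodPoly (p n : ℕ) [Fact p.Prime] (m j : ℕ) :
    toHBUn p n (steenrodPoly p (m + (p - 1) * j) j) = steenrodUn p n j (chernUn p n m) := by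
  ext1
  refine Eq.trans ?_ (aeval_steenrodPoly p n m j)
  have : (HBUn p n).val.comp (toHBUn p n) =
      aeval (fun l => esymm (Fin n) (ZMod p) (l + 1)) :=
    algHom_ext fun l => by simp [toHBUn, chernUn]
  exact DFunLike.congr_fun this _

theorem toHBU_steenrodPoly (p : ℕ) [Fact p.Prime] (m j : ℕ) :
    toHBU p (steenrodPoly p (m + (p - 1) * j) j) = steenrod p j (chern p m) := by
  ext1
  funext n
  refine Eq.trans ?_ (aeval_steenrodPoly p n m j)
  have : ((Pi.evalAlgHom (ZMod p) (fun n => HBT p (Fin n)) n).comp (HBU p).val).comp (toHBU p) =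
      aeval (fun l => esymm (Fin n) (ZMod p) (l + 1)) :=
    algHom_ext fun l => by simp [toHBU, chern]
  exact DFunLike.congr_fun this _

/-- If `p` does not divide `(m-1).choose j`, then `c_k`, `k = m + (p - 1) j`, is modulo products a
nonzero multiple of `P^j(c_m)`. -/
theorem exists_smul_steenrod (p : ℕ) [Fact p.Prime] {m j k : ℕ} (hm : m ≠ 0)
    (hk : k = m + (p - 1) * j) (h : ((m - 1).choose j : ZMod p) ≠ 0) :
    ∃ a : ZMod p, a ≠ 0 ∧
      chern p k - a • steenrod p j (chern p m) ∈ lowerProducts p (chern p) k ∧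
      ∀ n : ℕ, chernUn p n k - a • steenrodUn p n j (chernUn p n m) ∈
        lowerProducts p (chernUn p n) k := by
  obtain ⟨q, rfl⟩ := Nat.exists_eq_succ_of_ne_zero hm
  obtain rfl : k = q + (p - 1) * j + 1 := by omega
  rw [Nat.succ_sub_one] at h
  set α := coeff (Finsupp.single (q + (p - 1) * j) 1) (steenrodPoly p (q + (p - 1) * j + 1) j)
    with hα
  have hα0 : α ≠ 0 := by
    intro h0
    have := coeff_steenrodPoly p q j
    rw [← hα, h0, zero_mul] at this
    exact mul_ne_zero (pow_ne_zero _ (neg_ne_zero.2 one_ne_zero)) h this.symm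
  -- The relation is proved in `ChernRing p`, before any `n` is chosen; this makes the scalar
  -- uniform.
  have hmem : formalChern p (q + (p - 1) * j + 1) -
      α⁻¹ • steenrodPoly p (q.succ + (p - 1) * j) j ∈
        lowerProducts p (formalChern p) (q + (p - 1) * j + 1) := by
    have := Submodule.smul_mem _ (-α⁻¹) (sub_mem_lowerProducts p (q + (p - 1) * j) _
      (seriesNorm_mem_weightedSeries p (p - 1) (q + (p - 1) * j + 1) j))
    convert this using 1
    rw [smul_sub, smul_smul, neg_mul]
    change _ = _ - (-(α⁻¹ * α)) • _
    rw [inv_mul_cancel₀ hα0, show q.succ + (p - 1) * j = q + (p - 1) * j + 1 by omega]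
    simp only [neg_smul, one_smul]
    rw [steenrodPoly]
    ring
  refine ⟨α⁻¹, inv_ne_zero hα0, ?_, fun n => ?_⟩
  · have := lowerProducts_map p (toHBU p) (toHBU_formalChern p) _ hmem
    rwa [map_sub, map_smul, toHBU_steenrodPoly, toHBU_formalChern] at this
  · have := lowerProducts_map p (toHBUn p n) (toHBUn_formalChern p n) _ hmem
    rwa [map_sub, map_smul, toHBUn_steenrodPoly, toHBUn_formalChern] at this

/-- A case of Lucas' theorem. -/
theorem choose_mul_pow_sub_one (p : ℕ) [Fact p.Prime] (i a b : ℕ) :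
    (((a + 1) * p ^ i - 1).choose (b * p ^ i) : ZMod p) = (a.choose b : ZMod p) := by
  have hp := (Fact.out : p.Prime).pos
  induction i with
  | zero => simp
  | succ i ih =>
    rw [← ih]
    have hpos : 0 < (a + 1) * p ^ i := by positivity
    obtain ⟨c, hc⟩ := Nat.exists_eq_succ_of_ne_zero hpos.ne'
    -- The last base-`p` digit is `p - 1` above and `0` below, so Lucas contributes the factor `(p -
    -- 1).choose 0 = 1`.
    have e1 : (a + 1) * p ^ (i + 1) - 1 = (p - 1) + p * c := by
      rw [pow_succ, ← mul_assoc, hc, Nat.succ_mul, mul_comm c p]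
      omega
    have e2 : b * p ^ (i + 1) = p * (b * p ^ i) := by ring
    have h := (ZMod.natCast_eq_natCast_iff _ _ _).2
      (Choose.choose_modEq_choose_mod_mul_choose_div_nat (p := p)
        (n := (p - 1) + p * c) (k := p * (b * p ^ i)))
    rw [e1, e2, h, hc, Nat.add_mul_div_left _ _ hp, Nat.div_eq_of_lt (by omega),
      Nat.mul_mod_right, Nat.mul_div_cancel_left _ hp]
    simp

end

end CohomologyBU

/-- Write `k = l * p ^ i` with `p ∤ l` and `p < l`. Modulo products of Chern classes of lower
degree, `c_k` is a nonzero multiple of `P^{p^i}(c_{(l-p+1)p^i})` (`p` any prime), and, if `p = 2`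
and `l ≡ 1 mod 4`, also of `P^{2^{i+1}}(c_{(l-2)2^i})`. The same relations, with the same nonzero
scalar, hold in `H^*(BU(n); Z_p)` for every `n`. -/
theorem mainTheorem8 (p : ℕ) [Fact p.Prime] (i l k : ℕ) (hk : k = l * p ^ i)
    (hpl : ¬ p ∣ l) (hl : p < l) :
    (∃ a : ZMod p, a ≠ 0 ∧
      CohomologyBU.chern p k
          - a • CohomologyBU.steenrod p (p ^ i) (CohomologyBU.chern p ((l - p + 1) * p ^ i))
        ∈ CohomologyBU.lowerProducts p (CohomologyBU.chern p) k ∧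
      ∀ n : ℕ,
        CohomologyBU.chernUn p n k
            - a • CohomologyBU.steenrodUn p n (p ^ i)
                (CohomologyBU.chernUn p n ((l - p + 1) * p ^ i))
          ∈ CohomologyBU.lowerProducts p (CohomologyBU.chernUn p n) k) ∧
    (p = 2 → l % 4 = 1 → ∃ a : ZMod p, a ≠ 0 ∧
      CohomologyBU.chern p k
          - a • CohomologyBU.steenrod p (2 ^ (i + 1)) (CohomologyBU.chern p ((l - 2) * 2 ^ i))
        ∈ CohomologyBU.lowerProducts p (CohomologyBU.chern p) k ∧
      ∀ n : ℕ,
        CohomologyBU.chernUn p n k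
            - a • CohomologyBU.steenrodUn p n (2 ^ (i + 1))
                (CohomologyBU.chernUn p n ((l - 2) * 2 ^ i))
          ∈ CohomologyBU.lowerProducts p (CohomologyBU.chernUn p n) k) := by
  have hp := (Fact.out : p.Prime).two_le
  constructor
  · refine CohomologyBU.exists_smul_steenrod p ?_ ?_ ?_
    · have : 0 < (l - p + 1) * p ^ i := by positivity
      exact this.ne'
    · rw [hk, ← add_mul]
      congr 1
      omega
    -- The binomial coefficient reduces to `(l - p).choose 1 = l - p`, congruent to `l` mod `p`.
    · have := CohomologyBU.choose_mul_pow_sub_one p i (l - p) 1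
      rw [one_mul] at this
      rw [this, Nat.choose_one_right, Nat.cast_sub hl.le, ZMod.natCast_self, sub_zero]
      rwa [Ne, ZMod.natCast_eq_zero_iff]
  · rintro rfl hl4
    obtain ⟨r, rfl⟩ : ∃ r, l = 4 * r + 5 := ⟨l / 4 - 1, by omega⟩
    refine CohomologyBU.exists_smul_steenrod 2 ?_ ?_ ?_
    · have : 0 < (4 * r + 5 - 2) * 2 ^ i := Nat.mul_pos (by omega) (by positivity)
      exact this.ne'
    · rw [hk, pow_succ, show 4 * r + 5 - 2 = 4 * r + 3 by omega]
      ring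
    -- Here `a = l - 3 = 4 r + 2` and `b = 2`, and `a.choose 2 = (2 r + 1) (4 r + 1)` is odd.
    · rw [pow_succ', show 4 * r + 5 - 2 = 4 * r + 2 + 1 by omega,
        CohomologyBU.choose_mul_pow_sub_one, Ne, ZMod.natCast_eq_zero_iff, Nat.choose_two_right,
        show (4 * r + 2) * (4 * r + 2 - 1) = 2 * ((2 * r + 1) * (4 * r + 1)) by
          rw [show 4 * r + 2 - 1 = 4 * r + 1 by omega]; ring,
        Nat.mul_div_cancel_left _ two_pos, ← even_iff_two_dvd, Nat.not_even_iff_odd]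
      exact Odd.mul ⟨r, rfl⟩ ⟨2 * r, by ring⟩
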